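/- Let $(\mathcal X_t)_{t\ge 0}$ be a continuous-time Markov chain on the finite state space $\{1,2,\dots,s\}$, $s\ge 2$, with irreducible transition rate matrix $Q$, and write $\mathrm P_i,\mathrm E_i$ for probability and expectation when the chain starts from $i$. For $\varepsilon\in\{1,2\}$ let $\sigma_\varepsilon$ be the first time, after leaving the initial state, at which the chain is in $\varepsilon$: \[\sigma_\varepsilon=\begin{cases}\inf\{t>0:\ \exists u\in(0,t),\ \mathcal X_u\ne\varepsilon,\ \mathcal X_t=\varepsilon\},&\text{if }\mathcal X_0=\varepsilon,\\ \inf\{t>0:\ \mathcal X_t=\varepsilon\},&\text{otherwise.}\end{cases}\] For $\varepsilon'\in\{1,2\}$, $j\in\{3,\dots,s\}$ and $i\in\{1,\dots,s\}$ put \[\chi_{\varepsilon'}(j)=\int_0^{\sigma_{\varepsilon'}}\mathbf 1(\mathcal X_t=j)\,\mathrm dt,\qquad p_{i\varepsilon'}=\mathrm P_i(\sigma_{\varepsilon'}<\sigma_{3-\varepsilon'}),\qquad u_i(j)=\mathrm E_i\big[\chi_{\varepsilon'}(j)\,\mathbf 1(\sigma_{\varepsilon'}<\sigma_{3-\varepsilon'})\big],\]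 and define the conditional expectation $\mathrm E_{i\varepsilon'}[\chi_{\varepsilon'}(j)]$ of $\chi_{\varepsilon'}(j)$ given $\sigma_{\varepsilon'}<\sigma_{3-\varepsilon'}$, for the chain started from $i$, as $u_i(j)/p_{i\varepsilon'}$ if $p_{i\varepsilon'}\neq 0$ and as $0$ if $p_{i\varepsilon'}=0$. Let $Q_0$ be the matrix obtained from $Q$ by replacing all off-diagonal entries of its first two columns by $0$, and let $\mathbf e_j\in\mathbb R^s$ be the $j$th unit vector. Then for every $\varepsilon'\in\{1,2\}$ and $j\in\{3,\dots,s\}$ the expectations $u_i(j)$ are finite and nonnegative, and $u(j)=(u_1(j),\dots,u_s(j))^{\mathrm T}$ is the unique solution in $\mathbb R^s$ of \[Q_0\,u(j)=-p_{j\varepsilon'}\,\mathbf e_j .\] Moreover, for every $i\in\{1,\dots,s\}$: if $u_i(j)=0$, then $\mathrm E_{i\varepsilon'}[\chi_{\varepsilon'}(j)]=0$; if $u_i(j)>0$, then $p_{i\varepsilon'}>0$ and $\mathrm E_{i\varepsilon'}[\chi_{\varepsilon'}(j)]=u_i(j)/p_{i\varepsilon'}$. -/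

import Mathlib

open MeasureTheory
open scoped NNReal ENNReal

noncomputable section

namespace JumpProcess

variable {V Ω : Type*} [Fintype V] [DecidableEq V]

/-- `Q` is a transition rate matrix: nonnegative rates off the diagonal, and
`Q i i = -∑_{k ≠ i} Q i k`. -/
structure IsRateMatrix (Q : Matrix V V ℝ) : Prop where
  nonneg : ∀ i k, i ≠ k → 0 ≤ Q i k
  diag : ∀ i, Q i i = -∑ k ∈ Finset.univ.erase i, Q i k

/-- Every state can be reached from every other one by transitions of positive rate. -/
def IsIrreducibleRate (Q : Matrix V V ℝ) : Prop :=
  ∀ i k, Relation.ReflTransGen (fun a b => a ≠ b ∧ 0 < Q a b) i k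

/-- Transition matrix of the embedded jump chain (an absorbing state jumps to itself). -/
def jumpMatrix (Q : Matrix V V ℝ) : Matrix V V ℝ := fun i k =>
  if Q i i = 0 then (if k = i then 1 else 0)
  else if k = i then 0 else Q i k / (-Q i i)

/-- Time of the `n`-th jump, for the sequence `S` of successive holding times. -/
def jumpTime (S : ℕ → Ω → ℝ≥0∞) (n : ℕ) (ω : Ω) : ℝ≥0∞ := ∑ k ∈ Finset.range n, S k ω

/-- Under `μ`, the process `X` is a continuous-time Markov chain with rate matrix `Q` started from
`i` (jump chain and holding time definition): there are a jump chain `Y` and holding times `S` such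
that `Y` is a discrete-time Markov chain started from `i` with transition matrix `jumpMatrix Q`,
given `Y` the holding times are independent and `S k` is exponential with rate `-Q (Y k) (Y k)`
(infinite if this rate is zero), and almost surely `X` is equal to `Y n` from the `n`-th jump time
on until just before the next one. The state space being finite, the jump times almost surely tend
to infinity, so that this determines almost every path at all times. -/
def IsMarkovJumpProcess [MeasurableSpace V] [MeasurableSpace Ω] (Q : Matrix V V ℝ) (i : V)
    (μ : Measure Ω) (X : ℝ≥0 → Ω → V) : Prop :=
  ∃ (Y : ℕ → Ω → V) (S : ℕ → Ω → ℝ≥0∞),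
    (∀ n, Measurable (Y n)) ∧ (∀ n, Measurable (S n)) ∧
    (∀ (n : ℕ) (y : ℕ → V) (t : ℕ → ℝ≥0),
      μ {ω | ∀ k ≤ n, Y k ω = y k ∧ (t k : ℝ≥0∞) < S k ω} =
        (if y 0 = i then 1 else 0) *
          (∏ k ∈ Finset.range n, ENNReal.ofReal (jumpMatrix Q (y k) (y (k + 1)))) *
          ∏ k ∈ Finset.range (n + 1), ENNReal.ofReal (Real.exp (Q (y k) (y k) * t k))) ∧
    (∀ᵐ ω ∂μ, ∀ (n : ℕ) (t : ℝ≥0),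
      jumpTime S n ω ≤ t → (t : ℝ≥0∞) < jumpTime S (n + 1) ω → X t ω = Y n ω)

/-- First time at which the path `x` is in state `e` after leaving its initial state: the first
return to `e` if `x` starts in `e`, and the first hit of `e` otherwise (`∞` if there is none). -/
def hitTime (x : ℝ≥0 → V) (e : V) : ℝ≥0∞ :=
  if x 0 = e then
    ⨅ (t : ℝ≥0) (_ : 0 < t ∧ (∃ u, 0 < u ∧ u < t ∧ x u ≠ e) ∧ x t = e), (t : ℝ≥0∞)
  else
    ⨅ (t : ℝ≥0) (_ : 0 < t ∧ x t = e), (t : ℝ≥0∞)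

/-- Time spent by the path `x` in the state `j` before it hits `e`. -/
def timeSpent (x : ℝ≥0 → V) (e j : V) : ℝ≥0∞ :=
  ∫⁻ t : ℝ in Set.Ici 0,
    Set.indicator {t : ℝ | ENNReal.ofReal t < hitTime x e ∧ x t.toNNReal = j} (fun _ => 1) t

/-- The event that `X` hits `e` before `f`. -/
def hitsBefore (X : ℝ≥0 → Ω → V) (e f : V) : Set Ω :=
  {ω | hitTime (fun t => X t ω) e < hitTime (fun t => X t ω) f}

/-- The random variable equal to the time spent in `j` before hitting `e` on the event that `e` is
hit before `f` (where this time is finite), and to `0` off this event. -/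
def restrictedTime (X : ℝ≥0 → Ω → V) (e f j : V) : Ω → ℝ :=
  (hitsBefore X e f).indicator fun ω => (timeSpent (fun t => X t ω) e j).toReal

/-- Probability, under `μ`, of hitting `e` before `f`. -/
def hitProb [MeasurableSpace Ω] (μ : Measure Ω) (X : ℝ≥0 → Ω → V) (e f : V) : ℝ :=
  μ.real (hitsBefore X e f)

/-- Expected time spent in `j` before hitting `e`, on the event that `e` is hit before `f`. -/
def meanTime [MeasurableSpace Ω] (μ : Measure Ω) (X : ℝ≥0 → Ω → V) (e f j : V) : ℝ :=
  ∫ ω, restrictedTime X e f j ω ∂μ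

/-- Conditional expectation of the time spent in `j` before hitting `e`, given that `e` is hit
before `f`; zero by convention if the condition has probability zero. -/
def condMeanTime [MeasurableSpace Ω] (μ : Measure Ω) (X : ℝ≥0 → Ω → V) (e f j : V) : ℝ :=
  if hitProb μ X e f ≠ 0 then meanTime μ X e f j / hitProb μ X e f else 0

/-- The matrix `Q` with all off-diagonal entries in the columns of the two states `a`, `b` replaced
by zero. -/
def reducedMatrix (Q : Matrix V V ℝ) (a b : V) : Matrix V V ℝ := fun i k =>
  if (k = a ∨ k = b) ∧ i ≠ k then 0 else Q i k

end JumpProcess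

end

/-! Everything reduces to the embedded jump chain. Let K be its transition matrix and M
(`tabooMatrix`) the matrix K with columns e and f set to zero, so that (M^n)(i,j) is the
probability, from i, of being in j at step n after avoiding e and f at steps 1, …, n. Let G = ∑ M^n.

If the first visit to {e, f} after step 0 happens at step m + 1 and in e, the time spent in j is the
sum of the holding times S_n over n ≤ m with Y_n = j. Given the whole jump chain, each has mean
1/(-Q j j), and the Markov property at step n factors the probability into (M^n)(i,j) · (M^(m-n)
K)(j,e). Summing over n ≤ m is a Cauchy product, whence u_i = G(i,j) · p_j / (-Q j j), where p_j = ∑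
(M^m K)(j,e) is the probability, from j, of hitting e before f (`lintegral_timeBeforeVisit`,
`hitProb_eq_tsum`).

On the other side Q₀ = D(1 - M), with D the diagonal of Q (`reducedMatrix_eq`), and G = 1 + MG, so
this u solves the system. A maximum principle makes 1 - M injective, which gives both uniqueness and
the convergence of G. The claims on conditional expectations hold because an integral over a null
event vanishes. -/

namespace JumpProcess

/-! ### The killed jump matrix, its Green function and the linear system -/

section Matrices

variable {V : Type*} [DecidableEq V] {Q : Matrix V V ℝ}

theorem jumpMatrix_self {i : V} (hi : Q i i < 0) : jumpMatrix Q i i = 0 := by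
  simp [jumpMatrix, hi.ne]

theorem jumpMatrix_of_ne {i k : V} (hi : Q i i < 0) (hik : i ≠ k) :
    jumpMatrix Q i k = Q i k / (-Q i i) := by
  simp [jumpMatrix, hi.ne, hik.symm]

/-- Transition matrix of the jump chain killed when it jumps to `e` or `f`. -/
noncomputable def tabooMatrix (Q : Matrix V V ℝ) (e f : V) : Matrix V V ℝ := fun i k =>
  if k = e ∨ k = f then 0 else jumpMatrix Q i k

theorem reducedMatrix_comm (Q : Matrix V V ℝ) (e f : V) :
    reducedMatrix Q e f = reducedMatrix Q f e := by
  funext i k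
  simp only [reducedMatrix, or_comm]

/-- The diagonal of the jump matrix is zero, so `1 - tabooMatrix` has unit diagonal; this matches
the diagonal of `Q`, which survives also in the columns e and f. -/
theorem reducedMatrix_eq {e f : V} (hneg : ∀ i, Q i i < 0) (i k : V) :
    reducedMatrix Q e f i k = Q i i * ((1 : Matrix V V ℝ) i k - tabooMatrix Q e f i k) := by
  by_cases hik : i = k
  · subst hik
    simp [reducedMatrix, tabooMatrix, jumpMatrix_self (hneg i)]
  · rw [reducedMatrix, tabooMatrix, Matrix.one_apply_ne hik]
    by_cases hk : k = e ∨ k = f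
    · rw [if_pos ⟨hk, hik⟩, if_pos hk]; simp
    · rw [if_neg fun h => hk h.1, if_neg hk, jumpMatrix_of_ne (hneg i) hik]
      field_simp [(hneg i).ne]
      ring

variable [Fintype V] {e f : V}

theorem IsRateMatrix.diag_neg (hQ : IsRateMatrix Q) (hirr : IsIrreducibleRate Q) {i k : V}
    (hik : i ≠ k) : Q i i < 0 := by
  obtain h | ⟨b, ⟨hb, hpos⟩, -⟩ := (hirr i k).cases_head
  · exact absurd h hik
  · rw [hQ.diag, neg_lt_zero]
    exact Finset.sum_pos' (fun c hc => hQ.nonneg _ _ (Finset.ne_of_mem_erase hc).symm)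
      ⟨b, Finset.mem_erase.2 ⟨hb.symm, Finset.mem_univ _⟩, hpos⟩

theorem IsRateMatrix.jumpMatrix_nonneg (hQ : IsRateMatrix Q) {i : V} (hi : Q i i < 0) (k : V) :
    0 ≤ jumpMatrix Q i k := by
  by_cases hik : i = k
  · rw [← hik, jumpMatrix_self hi]
  · rw [jumpMatrix_of_ne hi hik]
    exact div_nonneg (hQ.nonneg _ _ hik) (by linarith)

theorem IsRateMatrix.sum_jumpMatrix (hQ : IsRateMatrix Q) {i : V} (hi : Q i i < 0) :
    ∑ k, jumpMatrix Q i k = 1 := by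
  rw [← Finset.add_sum_erase _ _ (Finset.mem_univ i), jumpMatrix_self hi, zero_add,
    Finset.sum_congr rfl fun k hk => jumpMatrix_of_ne hi (Finset.ne_of_mem_erase hk).symm,
    ← Finset.sum_div, hQ.diag i, neg_neg]
  refine div_self fun h => ?_
  rw [hQ.diag, h] at hi
  simp at hi

theorem IsRateMatrix.tabooMatrix_nonneg (hQ : IsRateMatrix Q) (hneg : ∀ i, Q i i < 0) (i k : V) :
    0 ≤ tabooMatrix Q e f i k := by
  unfold tabooMatrix
  split_ifs
  · exact le_rfl
  · exact hQ.jumpMatrix_nonneg (hneg i) k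

theorem IsRateMatrix.tabooMatrix_le (hQ : IsRateMatrix Q) (hneg : ∀ i, Q i i < 0) (i k : V) :
    tabooMatrix Q e f i k ≤ jumpMatrix Q i k := by
  unfold tabooMatrix
  split_ifs
  · exact hQ.jumpMatrix_nonneg (hneg i) k
  · exact le_rfl

theorem IsRateMatrix.tabooMatrix_pow_nonneg (hQ : IsRateMatrix Q) (hneg : ∀ i, Q i i < 0) (n : ℕ)
    (i k : V) : 0 ≤ (tabooMatrix Q e f ^ n) i k := by
  induction n generalizing k with
  | zero => rw [pow_zero, Matrix.one_apply]; split_ifs <;> norm_num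
  | succ n ih =>
    rw [pow_succ, Matrix.mul_apply]
    exact Finset.sum_nonneg fun l _ => mul_nonneg (ih l) (hQ.tabooMatrix_nonneg hneg l k)

theorem IsRateMatrix.sum_tabooMatrix_pow_le_one (hQ : IsRateMatrix Q) (hneg : ∀ i, Q i i < 0)
    (n : ℕ) (i : V) : ∑ k, (tabooMatrix Q e f ^ n) i k ≤ 1 := by
  induction n with
  | zero => simp [Matrix.one_apply]
  | succ n ih =>
    refine le_trans ?_ ih
    simp_rw [pow_succ, Matrix.mul_apply]
    rw [Finset.sum_comm]
    refine Finset.sum_le_sum fun l _ => ?_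
    rw [← Finset.mul_sum]
    refine mul_le_of_le_one_right (hQ.tabooMatrix_pow_nonneg hneg n i l) ?_
    rw [← hQ.sum_jumpMatrix (hneg l)]
    exact Finset.sum_le_sum fun k _ => hQ.tabooMatrix_le hneg l k

/-- Maximum principle for the killed jump chain. -/
theorem IsRateMatrix.eq_zero_of_tabooMatrix_mulVec_eq (hQ : IsRateMatrix Q)
    (hirr : IsIrreducibleRate Q) (hneg : ∀ i, Q i i < 0) {u : V → ℝ}
    (hu : (tabooMatrix Q e f).mulVec u = u) : u = 0 := by
  have : Nonempty V := ⟨e⟩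
  obtain ⟨a, ha⟩ := Finite.exists_max fun i => |u i|
  by_contra hne
  have hpos : 0 < |u a| := by
    obtain ⟨b, hb⟩ := Function.ne_iff.1 hne
    exact (abs_pos.2 hb).trans_le (ha b)
  -- Equality case: at a maximiser i of |u|, a weighted mean of values at most |u a| equals |u a|,
  -- so each k charged by row i is a maximiser too and cannot be a killed state.
  have step : ∀ i k, |u i| = |u a| → i ≠ k → 0 < Q i k → k ≠ e ∧ |u k| = |u a| := by
    intro i k hi hik hQik
    have h1 : |u i| ≤ ∑ l, tabooMatrix Q e f i l * |u l| := by
      conv_lhs => rw [← hu]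
      refine (Finset.abs_sum_le_sum_abs _ _).trans (Finset.sum_le_sum fun l _ => ?_)
      rw [abs_mul, abs_of_nonneg (hQ.tabooMatrix_nonneg hneg i l)]
    have h2 : ∀ l, tabooMatrix Q e f i l * |u l| ≤ jumpMatrix Q i l * |u a| := fun l =>
      mul_le_mul (hQ.tabooMatrix_le hneg i l) (ha l) (abs_nonneg _)
        (hQ.jumpMatrix_nonneg (hneg i) l)
    have h3 : ∑ l, jumpMatrix Q i l * |u a| = |u a| := by
      rw [← Finset.sum_mul, hQ.sum_jumpMatrix (hneg i), one_mul]
    have h4 : tabooMatrix Q e f i k * |u k| = jumpMatrix Q i k * |u a| := by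
      by_contra hlt
      have := Finset.sum_lt_sum (fun l _ => h2 l)
        ⟨k, Finset.mem_univ k, lt_of_le_of_ne (h2 k) hlt⟩
      linarith
    have hK : 0 < jumpMatrix Q i k := by
      rw [jumpMatrix_of_ne (hneg i) hik]
      exact div_pos hQik (by linarith [hneg i])
    by_cases hk : k = e ∨ k = f
    · rw [tabooMatrix, if_pos hk, zero_mul] at h4
      exact absurd h4 (mul_pos hK hpos).ne
    · rw [tabooMatrix, if_neg hk] at h4
      exact ⟨fun h => hk (Or.inl h), mul_left_cancel₀ hK.ne' h4⟩
  have reach : ∀ k, Relation.ReflTransGen (fun a b => a ≠ b ∧ 0 < Q a b) a k →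
      |u k| = |u a| := by
    intro k hk
    induction hk with
    | refl => rfl
    | tail _ h ih => exact (step _ _ ih h.1 h.2).2
  -- With e as the only state, its diagonal rate would be an empty sum, hence zero.
  have hue : ∃ k, k ≠ e := by
    by_contra! hall
    have := hQ.diag e
    rw [Finset.sum_eq_zero fun k hk => absurd (hall k) (Finset.ne_of_mem_erase hk)] at this
    linarith [hneg e]
  obtain ⟨k, hk⟩ := hue
  -- By irreducibility every state is a maximiser, in particular a predecessor b of e, contradicting
  -- `step`.
  obtain h | ⟨b, hb, hbe⟩ := (hirr k e).cases_tail
  · exact hk h.symm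
  · exact (step b e (reach b (hirr a b)) hbe.1 hbe.2).1 rfl

/-- Injectivity of 1 - M yields w with (1 - M)w = 1. Then the partial sums of M^m 1 telescope to w -
M^n w, which is bounded because M^n is substochastic; nonnegative terms with bounded partial sums
are summable. -/
theorem IsRateMatrix.summable_tabooMatrix_pow (hQ : IsRateMatrix Q)
    (hirr : IsIrreducibleRate Q) (hneg : ∀ i, Q i i < 0) (i k : V) :
    Summable fun n => (tabooMatrix Q e f ^ n) i k := by
  set M := tabooMatrix Q e f with hM
  have hinj : Function.Injective (1 - M).mulVec := by
    refine (injective_iff_map_eq_zero (Matrix.mulVecLin (1 - M))).2 fun u hu => ?_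
    refine hQ.eq_zero_of_tabooMatrix_mulVec_eq (e := e) (f := f) hirr hneg ?_
    rw [Matrix.mulVecLin_apply, Matrix.sub_mulVec, Matrix.one_mulVec] at hu
    exact (sub_eq_zero.1 hu).symm
  obtain ⟨w, hw⟩ : ∃ w, (1 - M).mulVec w = 1 :=
    (Matrix.mulVec_surjective_iff_isUnit.2 (Matrix.mulVec_injective_iff_isUnit.1 hinj)) 1
  obtain ⟨b, hb⟩ : ∃ b, ∀ l, |w l| ≤ b :=
    ⟨∑ l, |w l|, fun l => Finset.single_le_sum (f := fun l => |w l|)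
      (fun l _ => abs_nonneg _) (Finset.mem_univ l)⟩
  have hb0 : 0 ≤ b := (abs_nonneg _).trans (hb i)
  refine summable_of_sum_range_le (c := b + b)
    (fun n => hQ.tabooMatrix_pow_nonneg hneg n i k) fun n => ?_
  have hle : ∀ m, (M ^ m) i k ≤ (M ^ m).mulVec 1 i := fun m => by
    simp only [Matrix.mulVec, dotProduct, Pi.one_apply, mul_one]
    exact Finset.single_le_sum (f := fun k => (M ^ m) i k)
      (fun l _ => hQ.tabooMatrix_pow_nonneg hneg m i l) (Finset.mem_univ k)
  refine (Finset.sum_le_sum fun m _ => hle m).trans ?_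
  have htel : ∑ m ∈ Finset.range n, (M ^ m).mulVec 1 i = w i - (M ^ n).mulVec w i := by
    have : ∀ m, (M ^ m).mulVec 1 i = (M ^ m).mulVec w i - (M ^ (m + 1)).mulVec w i := fun m => by
      rw [← hw, Matrix.mulVec_mulVec, mul_sub, mul_one, ← pow_succ, Matrix.sub_mulVec,
        Pi.sub_apply]
    rw [Finset.sum_congr rfl fun m _ => this m, Finset.sum_range_sub', pow_zero,
      Matrix.one_mulVec]
  have hMw : |(M ^ n).mulVec w i| ≤ b := by
    refine (Finset.abs_sum_le_sum_abs _ _).trans ?_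
    calc ∑ l, |(M ^ n) i l * w l| ≤ ∑ l, (M ^ n) i l * b := Finset.sum_le_sum fun l _ => by
          have h0 := hQ.tabooMatrix_pow_nonneg (e := e) (f := f) hneg n i l
          rw [abs_mul, abs_of_nonneg h0]
          exact mul_le_mul_of_nonneg_left (hb l) h0
      _ ≤ b := by
          rw [← Finset.sum_mul]
          exact mul_le_of_le_one_left hb0 (hQ.sum_tabooMatrix_pow_le_one hneg n i)
  rw [htel]
  linarith [le_abs_self (w i), neg_abs_le ((M ^ n).mulVec w i), hb i]

theorem IsRateMatrix.tabooMatrix_pow_mul_jumpMatrix_nonneg (hQ : IsRateMatrix Q)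
    (hneg : ∀ i, Q i i < 0) (e f : V) (n : ℕ) (i k : V) :
    0 ≤ (tabooMatrix Q e f ^ n * jumpMatrix Q) i k := by
  rw [Matrix.mul_apply]
  exact Finset.sum_nonneg fun a _ => mul_nonneg (hQ.tabooMatrix_pow_nonneg hneg n i a)
    (hQ.jumpMatrix_nonneg (hneg a) k)

theorem IsRateMatrix.summable_tabooMatrix_pow_mul_jumpMatrix (hQ : IsRateMatrix Q)
    (hirr : IsIrreducibleRate Q) (hneg : ∀ i, Q i i < 0) (e f : V) (i k : V) :
    Summable fun n => (tabooMatrix Q e f ^ n * jumpMatrix Q) i k := by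
  simp_rw [Matrix.mul_apply]
  exact summable_sum fun a _ => (hQ.summable_tabooMatrix_pow hirr hneg i a).mul_right _

/-- The Green function of the killed jump chain solves its defining linear system. -/
theorem IsRateMatrix.tsum_tabooMatrix_pow (hQ : IsRateMatrix Q)
    (hirr : IsIrreducibleRate Q) (hneg : ∀ i, Q i i < 0) (i k : V) :
    ∑' n, (tabooMatrix Q e f ^ n) i k =
      (1 : Matrix V V ℝ) i k + ∑ l, tabooMatrix Q e f i l * ∑' n, (tabooMatrix Q e f ^ n) l k := by
  rw [(hQ.summable_tabooMatrix_pow hirr hneg i k).tsum_eq_zero_add, pow_zero]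
  congr 1
  simp_rw [pow_succ', Matrix.mul_apply]
  rw [Summable.tsum_finsetSum fun l _ =>
    (hQ.summable_tabooMatrix_pow hirr hneg l k).mul_left _]
  simp_rw [tsum_mul_left]

/-- The Green function equation gives existence. For uniqueness, the difference of two solutions is
fixed by `tabooMatrix`, hence zero by the maximum principle. -/
theorem IsRateMatrix.reducedMatrix_mulVec_eq_iff (hQ : IsRateMatrix Q)
    (hirr : IsIrreducibleRate Q) (hneg : ∀ i, Q i i < 0) (j : V) (p : ℝ) (u : V → ℝ) :
    (reducedMatrix Q e f).mulVec u = -p • Pi.single j (1 : ℝ) ↔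
      u = fun i => (-Q j j)⁻¹ * p * ∑' n, (tabooMatrix Q e f ^ n) i j := by
  have key : ∀ v : V → ℝ, ∀ i, (reducedMatrix Q e f).mulVec v i =
      Q i i * (v i - (tabooMatrix Q e f).mulVec v i) := fun v i => by
    simp only [Matrix.mulVec, dotProduct, reducedMatrix_eq hneg, mul_assoc, ← Finset.mul_sum,
      sub_mul, Finset.sum_sub_distrib, Matrix.one_apply, ite_mul, one_mul, zero_mul,
      Finset.sum_ite_eq, Finset.mem_univ, if_true]
  have hsol : (reducedMatrix Q e f).mulVec
      (fun i => (-Q j j)⁻¹ * p * ∑' n, (tabooMatrix Q e f ^ n) i j) =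
        -p • Pi.single j (1 : ℝ) := by
    funext i
    rw [key, hQ.tsum_tabooMatrix_pow hirr hneg i j]
    simp only [Matrix.mulVec, dotProduct]
    simp_rw [mul_left_comm (tabooMatrix Q e f i _) ((-Q j j)⁻¹ * p), ← Finset.mul_sum]
    rw [mul_add, add_sub_cancel_right]
    by_cases hij : i = j
    · subst hij
      have := (hneg i).ne
      simp
      field_simp
    · simp [Matrix.one_apply_ne hij, hij]
  refine ⟨fun hu => ?_, fun hu => hu ▸ hsol⟩
  rw [← sub_eq_zero]
  refine hQ.eq_zero_of_tabooMatrix_mulVec_eq (e := e) (f := f) hirr hneg ?_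
  funext i
  have h := key (u - fun i => (-Q j j)⁻¹ * p * ∑' n, (tabooMatrix Q e f ^ n) i j) i
  rw [Matrix.mulVec_sub, hu, hsol, sub_self, Pi.zero_apply, eq_comm, mul_eq_zero,
    or_iff_right (hneg i).ne, sub_eq_zero] at h
  exact h.symm

end Matrices

end JumpProcess

namespace JumpProcess

/-! ### Laws of the jump chain and of the holding times -/

section Chain

variable {V Ω : Type*} [MeasurableSpace V] [MeasurableSpace Ω]

theorem measure_eq_sum_inter_preimage {β : Type*} [Fintype β] [MeasurableSpace β]
    [MeasurableSingletonClass β] (μ : Measure Ω) {Z : Ω → β} (hZ : Measurable Z) (T : Set Ω) :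
    μ T = ∑ z, μ (T ∩ Z ⁻¹' {z}) := by
  have h := sum_measure_preimage_singleton (μ := μ.restrict T) Finset.univ (f := Z)
    fun z _ => hZ (measurableSet_singleton z)
  rw [Finset.coe_univ, Set.preimage_univ, Measure.restrict_apply_univ] at h
  rw [← h]
  refine Finset.sum_congr rfl fun z _ => ?_
  rw [Measure.restrict_apply (hZ (measurableSet_singleton z)), Set.inter_comm]

/-- To prove a product formula on an event determined by `Y 0, …, Y m`, it is enough to prove it on
cylinders. -/
theorem measure_inter_eq_mul_of_cylinder [Fintype V] [MeasurableSingletonClass V]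
    {μ : Measure Ω} {Y : ℕ → Ω → V}
    (hY : ∀ n, Measurable (Y n)) {m : ℕ} {C A B : Set Ω} {c : ℝ≥0∞}
    (hC : ∀ ω ω', (∀ k ≤ m, Y k ω = Y k ω') → ω ∈ C → ω' ∈ C)
    (h : ∀ ω ∈ C, μ ({ω' | ∀ k ≤ m, Y k ω' = Y k ω} ∩ B) =
      μ ({ω' | ∀ k ≤ m, Y k ω' = Y k ω} ∩ A) * c) :
    μ (C ∩ B) = μ (C ∩ A) * c := by
  classical
  have hZ : Measurable fun ω (k : Fin (m + 1)) => Y k ω := measurable_pi_lambda _ fun k => hY k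
  rw [measure_eq_sum_inter_preimage μ hZ (C ∩ B), measure_eq_sum_inter_preimage μ hZ (C ∩ A),
    Finset.sum_mul]
  refine Finset.sum_congr rfl fun z _ => ?_
  -- As C depends only on the first m + 1 states, a fibre of (Y 0, …, Y m) meeting C lies inside it;
  -- the other fibres contribute nothing.
  by_cases hne : ∃ ω ∈ C, (fun k : Fin (m + 1) => Y k ω) = z
  · obtain ⟨ω, hω, rfl⟩ := hne
    have key : ∀ D : Set Ω, C ∩ D ∩ (fun ω (k : Fin (m + 1)) => Y k ω) ⁻¹'
        {fun k : Fin (m + 1) => Y k ω} = {ω' | ∀ k ≤ m, Y k ω' = Y k ω} ∩ D := fun D => by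
      ext ω'
      simp only [Set.mem_inter_iff, Set.mem_preimage, Set.mem_singleton_iff, Set.mem_ofPred_eq,
        funext_iff, Fin.forall_iff, Nat.lt_succ_iff]
      exact ⟨fun h' => ⟨h'.2, h'.1.2⟩,
        fun h' => ⟨⟨hC ω ω' (fun k hk => (h'.1 k hk).symm) hω, h'.2⟩, h'.1⟩⟩
    rw [key, key, h ω hω]
  · have key : ∀ D : Set Ω, C ∩ D ∩ (fun ω (k : Fin (m + 1)) => Y k ω) ⁻¹' {z} = ∅ := fun D =>
      Set.eq_empty_of_forall_notMem fun ω hω => hne ⟨ω, hω.1.1, hω.2⟩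
    rw [key, key, measure_empty, zero_mul]

variable [DecidableEq V]

/-- `Y` and `S` are the jump chain and the holding times of a Markov chain with rate matrix `Q`
started from `i`. -/
structure IsJumpHolding (Q : Matrix V V ℝ) (i : V) (μ : Measure Ω) (Y : ℕ → Ω → V)
    (S : ℕ → Ω → ℝ≥0∞) : Prop where
  measurable_chain : ∀ n, Measurable (Y n)
  measurable_holding : ∀ n, Measurable (S n)
  law : ∀ (n : ℕ) (y : ℕ → V) (t : ℕ → ℝ≥0),
      μ {ω | ∀ k ≤ n, Y k ω = y k ∧ (t k : ℝ≥0∞) < S k ω} =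
        (if y 0 = i then 1 else 0) *
          (∏ k ∈ Finset.range n, ENNReal.ofReal (jumpMatrix Q (y k) (y (k + 1)))) *
          ∏ k ∈ Finset.range (n + 1), ENNReal.ofReal (Real.exp (Q (y k) (y k) * t k))

namespace IsJumpHolding

variable {Q : Matrix V V ℝ} {i : V} {μ : Measure Ω} {Y : ℕ → Ω → V} {S : ℕ → Ω → ℝ≥0∞}

theorem law_zero (h : IsJumpHolding Q i μ Y S) (n : ℕ) (y : ℕ → V) :
    μ {ω | ∀ k ≤ n, Y k ω = y k ∧ 0 < S k ω} = (if y 0 = i then 1 else 0) *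
      ∏ k ∈ Finset.range n, ENNReal.ofReal (jumpMatrix Q (y k) (y (k + 1))) := by
  have := h.law n y 0
  simpa using this

theorem measurableSet_pos (h : IsJumpHolding Q i μ Y S) (n : ℕ) :
    MeasurableSet {ω | ∀ k ≤ n, 0 < S k ω} := by
  simp only [Set.ofPred_forall]
  exact MeasurableSet.iInter fun k => MeasurableSet.iInter fun _ =>
    measurableSet_lt measurable_const (h.measurable_holding k)

variable [MeasurableSingletonClass V]

theorem measurableSet_chain (h : IsJumpHolding Q i μ Y S) (n : ℕ) (a : V) :
    MeasurableSet {ω | Y n ω = a} :=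
  h.measurable_chain n (measurableSet_singleton a)

variable [Fintype V] [IsProbabilityMeasure μ]

/-- The law at zero thresholds describes the chain only jointly with the events `0 < S k`. Since the
rows of the jump matrix sum to 1, no mass is lost from one step to the next, so these events have
probability 1. -/
theorem ae_pos (h : IsJumpHolding Q i μ Y S) (hQ : IsRateMatrix Q) (hneg : ∀ i, Q i i < 0) :
    ∀ᵐ ω ∂μ, ∀ n, 0 < S n ω := by
  have hone : ∀ n, μ {ω | ∀ k ≤ n, 0 < S k ω} = 1 := by
    intro n
    induction n with
    | zero =>
      refine le_antisymm prob_le_one ?_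
      have := h.law_zero 0 fun _ => i
      simp only [if_true, Finset.range_zero, Finset.prod_empty, mul_one] at this
      rw [← this]
      exact measure_mono fun ω hω k hk => (hω k hk).2
    | succ n ih =>
      rw [← ih, measure_eq_sum_inter_preimage μ (h.measurable_chain n) {ω | ∀ k ≤ n, 0 < S k ω},
        measure_eq_sum_inter_preimage μ (h.measurable_chain n)]
      refine Finset.sum_congr rfl fun a _ => ?_
      rw [measure_eq_sum_inter_preimage μ (h.measurable_chain (n + 1)),
        ← mul_one (μ ({ω | ∀ k ≤ n, 0 < S k ω} ∩ Y n ⁻¹' {a})), ← ENNReal.ofReal_one,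
        ← hQ.sum_jumpMatrix (hneg a),
        ENNReal.ofReal_sum_of_nonneg fun b _ => hQ.jumpMatrix_nonneg (hneg a) b, Finset.mul_sum]
      refine Finset.sum_congr rfl fun b _ => ?_
      rw [Set.inter_comm _ (Y n ⁻¹' {a}), Set.inter_comm _ (Y n ⁻¹' {a}), Set.inter_assoc]
      refine measure_inter_eq_mul_of_cylinder h.measurable_chain (m := n) ?_ ?_
      · intro ω ω' hωω' hω
        exact (hωω' n le_rfl).symm.trans hω
      · intro ω hω
        have hω' : Y n ω = a := hω
        have h1 := h.law_zero n fun k => Y k ω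
        -- The path of ω up to step n, continued by b.
        have h2 := h.law_zero (n + 1) fun k => if k ≤ n then Y k ω else b
        rw [Finset.prod_range_succ, Finset.prod_congr rfl (g := fun k =>
          ENNReal.ofReal (jumpMatrix Q (Y k ω) (Y (k + 1) ω))), ← mul_assoc] at h2
        · simp only [le_refl, if_true, zero_le, Nat.not_succ_le_self, if_false] at h2
          rw [← h1, hω'] at h2
          convert h2 using 2
          · ext ω'
            simp only [Set.mem_inter_iff, Set.mem_ofPred_eq, Set.mem_preimage,
              Set.mem_singleton_iff]
            constructor
            · rintro ⟨h3, h4, h5⟩ k hk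
              refine ⟨?_, h4 k hk⟩
              split_ifs with hkn
              · exact h3 k hkn
              · rwa [show k = n + 1 by omega]
            · intro h3
              refine ⟨fun k hk => ?_, fun k hk => (h3 k hk).2, ?_⟩
              · have := (h3 k (by omega)).1
                rwa [if_pos hk] at this
              · have := (h3 (n + 1) le_rfl).1
                rwa [if_neg (by omega)] at this
          · congr 1
            ext ω'
            simp only [Set.mem_inter_iff, Set.mem_ofPred_eq, ← forall_and]
        · intro k hk
          have := Finset.mem_range.1 hk
          rw [if_pos (by omega), if_pos (by omega)]
  refine ae_all_iff.2 fun n => ?_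
  filter_upwards [(prob_compl_eq_zero_iff (h.measurableSet_pos n)).2 (hone n) |>
    fun h0 => (compl_mem_ae_iff.2 h0)] with ω hω
  rw [compl_compl] at hω
  exact hω n le_rfl

theorem measure_path (h : IsJumpHolding Q i μ Y S) (hQ : IsRateMatrix Q) (hneg : ∀ i, Q i i < 0)
    (n : ℕ) (y : ℕ → V) :
    μ {ω | ∀ k ≤ n, Y k ω = y k} = (if y 0 = i then 1 else 0) *
      ∏ k ∈ Finset.range n, ENNReal.ofReal (jumpMatrix Q (y k) (y (k + 1))) := by
  rw [← h.law_zero]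
  refine measure_congr ?_
  filter_upwards [h.ae_pos hQ hneg] with ω hω
  exact propext ⟨fun h' k hk => ⟨h' k hk, hω k⟩, fun h' k hk => (h' k hk).1⟩

theorem measure_path_inter_lt (h : IsJumpHolding Q i μ Y S) (hQ : IsRateMatrix Q)
    (hneg : ∀ i, Q i i < 0) {n m : ℕ} (hmn : m ≤ n) (y : ℕ → V) (t : ℝ≥0) :
    μ ({ω | ∀ k ≤ n, Y k ω = y k} ∩ {ω | (t : ℝ≥0∞) < S m ω}) =
      μ {ω | ∀ k ≤ n, Y k ω = y k} * ENNReal.ofReal (Real.exp (Q (y m) (y m) * t)) := by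
  -- Threshold t at step m and 0 elsewhere: the zero thresholds only demand positivity, which is
  -- almost sure.
  have hlaw := h.law n y (Pi.single m t)
  rw [← h.measure_path hQ hneg, Finset.prod_eq_single_of_mem m (by simpa using hmn)
    fun k _ hk => by simp [Pi.single_eq_of_ne hk], Pi.single_eq_same] at hlaw
  rw [← hlaw]
  refine measure_congr ?_
  filter_upwards [h.ae_pos hQ hneg] with ω hω
  refine propext ⟨fun h' k hk => ⟨h'.1 k hk, ?_⟩, fun h' => ⟨fun k hk => (h' k hk).1, ?_⟩⟩
  · by_cases hkm : k = m
    · subst hkm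
      simpa using h'.2
    · simpa [Pi.single_eq_of_ne hkm] using hω k
  · simpa using (h' m hmn).2

/-- One-step Markov property of the jump chain. -/
theorem measure_inter_succ (h : IsJumpHolding Q i μ Y S) (hQ : IsRateMatrix Q)
    (hneg : ∀ i, Q i i < 0) {m : ℕ} {C : Set Ω} {a : V} (b : V)
    (hC : ∀ ω ω', (∀ k ≤ m, Y k ω = Y k ω') → ω ∈ C → ω' ∈ C) (ha : ∀ ω ∈ C, Y m ω = a) :
    μ (C ∩ {ω | Y (m + 1) ω = b}) = μ C * ENNReal.ofReal (jumpMatrix Q a b) := by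
  rw [measure_inter_eq_mul_of_cylinder (A := Set.univ) (c := ENNReal.ofReal (jumpMatrix Q a b))
    h.measurable_chain hC, Set.inter_univ]
  intro ω hω
  have h2 := h.measure_path hQ hneg (m + 1) fun k => if k ≤ m then Y k ω else b
  rw [Finset.prod_range_succ, Finset.prod_congr rfl (g := fun k =>
    ENNReal.ofReal (jumpMatrix Q (Y k ω) (Y (k + 1) ω))), ← mul_assoc] at h2
  · simp only [le_refl, if_true, zero_le, Nat.not_succ_le_self, if_false] at h2
    rw [← h.measure_path hQ hneg m fun k => Y k ω, ha ω hω] at h2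
    rw [Set.inter_univ, ← h2]
    congr 1
    ext ω'
    simp only [Set.mem_inter_iff, Set.mem_ofPred_eq]
    constructor
    · rintro ⟨h3, h5⟩ k hk
      split_ifs with hkn
      · exact h3 k hkn
      · rwa [show k = m + 1 by omega]
    · intro h3
      refine ⟨fun k hk => ?_, ?_⟩
      · have := h3 k (by omega)
        rwa [if_pos hk] at this
      · have := h3 (m + 1) le_rfl
        rwa [if_neg (by omega)] at this
  · intro k hk
    have := Finset.mem_range.1 hk
    rw [if_pos (by omega), if_pos (by omega)]

/-- The event C may involve the chain after step n: holding times depend on the chain only through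
the state held. This is what allows conditioning on a later first visit. -/
theorem measure_inter_lt (h : IsJumpHolding Q i μ Y S) (hQ : IsRateMatrix Q)
    (hneg : ∀ i, Q i i < 0) {m n : ℕ} (hnm : n ≤ m) {C : Set Ω} {j : V}
    (hC : ∀ ω ω', (∀ k ≤ m, Y k ω = Y k ω') → ω ∈ C → ω' ∈ C) (hj : ∀ ω ∈ C, Y n ω = j)
    (t : ℝ≥0) :
    μ (C ∩ {ω | (t : ℝ≥0∞) < S n ω}) = μ C * ENNReal.ofReal (Real.exp (Q j j * t)) := by
  rw [measure_inter_eq_mul_of_cylinder (A := Set.univ)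
    (c := ENNReal.ofReal (Real.exp (Q j j * t))) h.measurable_chain hC, Set.inter_univ]
  intro ω hω
  rw [h.measure_path_inter_lt hQ hneg hnm (fun k => Y k ω), hj ω hω, Set.inter_univ]

theorem ae_lt_top (h : IsJumpHolding Q i μ Y S) (hQ : IsRateMatrix Q) (hneg : ∀ i, Q i i < 0) :
    ∀ᵐ ω ∂μ, ∀ n, S n ω < ∞ := by
  refine ae_all_iff.2 fun n => ?_
  rw [ae_iff, measure_eq_sum_inter_preimage μ (h.measurable_chain n)]
  refine Finset.sum_eq_zero fun j _ => le_antisymm ?_ zero_le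
  have hlim : Filter.Tendsto (fun t : ℕ => ENNReal.ofReal (Real.exp (Q j j * t))) Filter.atTop
      (nhds 0) := by
    rw [← ENNReal.ofReal_zero]
    refine (ENNReal.continuous_ofReal.tendsto 0).comp (Real.tendsto_exp_atBot.comp ?_)
    exact tendsto_natCast_atTop_atTop.const_mul_atTop_of_neg (hneg j)
  -- An infinite holding time exceeds every t, so its probability is at most exp(Q j j t), which
  -- tends to 0.
  refine ge_of_tendsto' hlim fun t => ?_
  have hlt := h.measure_inter_lt hQ hneg (m := n) le_rfl (C := Y n ⁻¹' {j}) (j := j)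
    (fun ω ω' hωω' hω => (hωω' n le_rfl).symm.trans hω) (fun ω hω => hω) t
  calc μ ({ω | ¬S n ω < ∞} ∩ Y n ⁻¹' {j})
      ≤ μ (Y n ⁻¹' {j} ∩ {ω | ((t : ℝ≥0) : ℝ≥0∞) < S n ω}) := by
        refine measure_mono fun ω hω => ⟨hω.2, ?_⟩
        have : S n ω = ∞ := by simpa using hω.1
        simp [this]
    _ ≤ ENNReal.ofReal (Real.exp (Q j j * t)) := by
        rw [hlt]
        exact (mul_le_mul_left prob_le_one _).trans_eq (by simp)

/-- Mean of a holding time in `j` over an event determined by the jump chain. -/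
theorem setLIntegral_holding (h : IsJumpHolding Q i μ Y S) (hQ : IsRateMatrix Q)
    (hneg : ∀ i, Q i i < 0) {m n : ℕ} (hnm : n ≤ m) {C : Set Ω} {j : V}
    (hC : ∀ ω ω', (∀ k ≤ m, Y k ω = Y k ω') → ω ∈ C → ω' ∈ C) (hj : ∀ ω ∈ C, Y n ω = j) :
    ∫⁻ ω in C, S n ω ∂μ = μ C * ENNReal.ofReal (-Q j j)⁻¹ := by
  have hfin : ∀ᵐ ω ∂μ.restrict C, S n ω < ∞ :=
    ae_restrict_of_ae ((h.ae_lt_top hQ hneg).mono fun ω hω => hω n)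
  have h1 : ∫⁻ ω in C, S n ω ∂μ = ∫⁻ ω in C, ENNReal.ofReal (S n ω).toReal ∂μ :=
    lintegral_congr_ae (hfin.mono fun ω hω => (ENNReal.ofReal_toReal hω.ne).symm)
  -- Layer-cake formula: the mean is the integral of the exponential tail.
  rw [h1, lintegral_eq_lintegral_meas_lt _ (.of_forall fun _ => ENNReal.toReal_nonneg)
    (h.measurable_holding n).ennreal_toReal.aemeasurable]
  have h2 : ∀ t ∈ Set.Ioi (0 : ℝ), (μ.restrict C) {ω | t < (S n ω).toReal} =
      μ C * ENNReal.ofReal (Real.exp (Q j j * t)) := fun t ht => by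
    have := h.measure_inter_lt hQ hneg hnm hC hj t.toNNReal
    rw [Real.coe_toNNReal t (le_of_lt ht)] at this
    rw [← this, Measure.restrict_apply (measurableSet_lt measurable_const
      (h.measurable_holding n).ennreal_toReal), Set.inter_comm]
    refine measure_congr ?_
    filter_upwards [h.ae_lt_top hQ hneg] with ω hω
    refine propext (and_congr_right fun _ => ?_)
    exact (ENNReal.ofReal_lt_iff_lt_toReal (le_of_lt ht) (hω n).ne).symm
  rw [setLIntegral_congr_fun measurableSet_Ioi h2, lintegral_const_mul _ (by fun_prop),
    ← ofReal_integral_eq_lintegral_ofReal (integrableOn_exp_mul_Ioi (hneg j) 0)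
      (.of_forall fun _ => (Real.exp_pos _).le), integral_exp_mul_Ioi (hneg j)]
  simp [inv_neg, neg_div]

end IsJumpHolding

end Chain

end JumpProcess

namespace JumpProcess

/-! ### Taboo probabilities and first visits of the jump chain -/

section HittingEvents

variable {V Ω : Type*} [Fintype V] [DecidableEq V]

/-- The jump chain avoids `e` and `f` at the steps `n + 1, …, n + l`. -/
def avoids (Y : ℕ → Ω → V) (e f : V) (n l : ℕ) : Set Ω :=
  {ω | ∀ k, n < k → k ≤ n + l → Y k ω ≠ e ∧ Y k ω ≠ f}

/-- After step zero, the jump chain visits `{e, f}` for the first time at step `m + 1`, in `e`. -/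
def firstVisit (Y : ℕ → Ω → V) (e f : V) (m : ℕ) : Set Ω :=
  avoids Y e f 0 m ∩ {ω | Y (m + 1) ω = e}

variable [MeasurableSpace V] [MeasurableSingletonClass V] [MeasurableSpace Ω]

namespace IsJumpHolding

variable {Q : Matrix V V ℝ} {i : V} {μ : Measure Ω} {Y : ℕ → Ω → V} {S : ℕ → Ω → ℝ≥0∞}

omit [Fintype V] in
theorem measurableSet_avoids (h : IsJumpHolding Q i μ Y S) (e f : V) (n l : ℕ) :
    MeasurableSet (avoids Y e f n l) := by
  simp only [avoids, Set.ofPred_forall]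
  exact MeasurableSet.iInter fun k => MeasurableSet.iInter fun _ => MeasurableSet.iInter fun _ =>
    (h.measurableSet_chain k e).compl.inter (h.measurableSet_chain k f).compl

omit [Fintype V] in
theorem measurableSet_firstVisit (h : IsJumpHolding Q i μ Y S) (e f : V) (m : ℕ) :
    MeasurableSet (firstVisit Y e f m) :=
  (h.measurableSet_avoids e f 0 m).inter (h.measurableSet_chain (m + 1) e)

variable [IsProbabilityMeasure μ]

/-- Markov property over l steps with killing, by induction on l: the last step either enters {e,
f}, where both sides vanish, or follows the unmodified jump matrix. -/
theorem measure_inter_avoids (h : IsJumpHolding Q i μ Y S) (hQ : IsRateMatrix Q)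
    (hneg : ∀ i, Q i i < 0) {e f : V} {n : ℕ} {C : Set Ω} {j : V}
    (hC : ∀ ω ω', (∀ k ≤ n, Y k ω = Y k ω') → ω ∈ C → ω' ∈ C) (hj : ∀ ω ∈ C, Y n ω = j)
    (l : ℕ) (k : V) :
    μ (C ∩ avoids Y e f n l ∩ {ω | Y (n + l) ω = k}) =
      μ C * ENNReal.ofReal ((tabooMatrix Q e f ^ l) j k) := by
  induction l generalizing k with
  | zero =>
    have havoid : avoids Y e f n 0 = Set.univ :=
      Set.eq_univ_of_forall fun ω k h1 h2 => absurd h1 (by omega)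
    rw [havoid, Set.inter_univ, pow_zero, Matrix.one_apply, add_zero]
    split_ifs with hjk
    · rw [Set.inter_eq_left.2 (show C ⊆ {ω | Y n ω = k} from fun ω hω => (hj ω hω).trans hjk), ENNReal.ofReal_one, mul_one]
    · rw [ENNReal.ofReal_zero, mul_zero]
      convert measure_empty (μ := μ)
      exact Set.eq_empty_of_forall_notMem fun ω hω => hjk ((hj ω hω.1).symm.trans hω.2)
  | succ l ih =>
    rw [pow_succ, Matrix.mul_apply]
    by_cases hk : k = e ∨ k = f
    · simp only [tabooMatrix, if_pos hk, mul_zero, Finset.sum_const_zero, ENNReal.ofReal_zero]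
      convert measure_empty (μ := μ)
      refine Set.eq_empty_of_forall_notMem fun ω hω => ?_
      have h1 := hω.1.2 (n + (l + 1)) (by omega) le_rfl
      have h2 : Y (n + (l + 1)) ω = k := hω.2
      rw [h2] at h1
      exact hk.elim h1.1 h1.2
    · rw [ENNReal.ofReal_sum_of_nonneg fun a _ => mul_nonneg
        (hQ.tabooMatrix_pow_nonneg hneg l j a) (hQ.tabooMatrix_nonneg hneg a k), Finset.mul_sum,
        measure_eq_sum_inter_preimage μ (h.measurable_chain (n + l))]
      refine Finset.sum_congr rfl fun a _ => ?_
      rw [ENNReal.ofReal_mul (hQ.tabooMatrix_pow_nonneg hneg l j a), ← mul_assoc, ← ih,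
        tabooMatrix, if_neg hk, ← h.measure_inter_succ hQ hneg (m := n + l) k _ fun ω hω => hω.2]
      · congr 1
        ext ω
        simp only [avoids, Set.mem_inter_iff, Set.mem_ofPred_eq, Set.mem_preimage,
          Set.mem_singleton_iff]
        constructor
        · rintro ⟨⟨⟨h1, h2⟩, h3⟩, h4⟩
          exact ⟨⟨⟨h1, fun m hm hml => h2 m hm (by omega)⟩, h4⟩, h3⟩
        · rintro ⟨⟨⟨h1, h2⟩, h4⟩, h3⟩
          refine ⟨⟨⟨h1, fun m hm hml => ?_⟩, h3⟩, h4⟩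
          rcases eq_or_lt_of_le hml with rfl | hlt
          · rw [show n + (l + 1) = n + l + 1 by omega, h3]
            exact not_or.1 hk
          · exact h2 m hm (by omega)
      · rintro ω ω' hωω' ⟨⟨h1, h2⟩, h3⟩
        refine ⟨⟨hC ω ω' (fun m hm => hωω' m (by omega)) h1, fun m hm hml => ?_⟩, ?_⟩
        · rw [← hωω' m hml]
          exact h2 m hm hml
        · exact (hωω' _ le_rfl).symm.trans h3

theorem measure_inter_avoids_inter_succ (h : IsJumpHolding Q i μ Y S) (hQ : IsRateMatrix Q)
    (hneg : ∀ i, Q i i < 0) {e f : V} {n : ℕ} {C : Set Ω} {j : V}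
    (hC : ∀ ω ω', (∀ k ≤ n, Y k ω = Y k ω') → ω ∈ C → ω' ∈ C) (hj : ∀ ω ∈ C, Y n ω = j)
    (l : ℕ) (k : V) :
    μ (C ∩ avoids Y e f n l ∩ {ω | Y (n + l + 1) ω = k}) =
      μ C * ENNReal.ofReal ((tabooMatrix Q e f ^ l * jumpMatrix Q) j k) := by
  rw [Matrix.mul_apply, ENNReal.ofReal_sum_of_nonneg fun a _ => mul_nonneg
    (hQ.tabooMatrix_pow_nonneg hneg l j a) (hQ.jumpMatrix_nonneg (hneg a) k), Finset.mul_sum,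
    measure_eq_sum_inter_preimage μ (h.measurable_chain (n + l))]
  refine Finset.sum_congr rfl fun a _ => ?_
  rw [ENNReal.ofReal_mul (hQ.tabooMatrix_pow_nonneg hneg l j a), ← mul_assoc,
    ← h.measure_inter_avoids hQ hneg hC hj, Set.inter_right_comm,
    ← h.measure_inter_succ hQ hneg (m := n + l) k _ fun ω hω => hω.2]
  · rfl
  · rintro ω ω' hωω' ⟨⟨h1, h2⟩, h3⟩
    refine ⟨⟨hC ω ω' (fun m hm => hωω' m (by omega)) h1, fun m hm hml => ?_⟩, ?_⟩
    · rw [← hωω' m hml]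
      exact h2 m hm hml
    · exact (hωω' _ le_rfl).symm.trans h3

theorem measure_chain_zero (h : IsJumpHolding Q i μ Y S) (hQ : IsRateMatrix Q)
    (hneg : ∀ i, Q i i < 0) : μ {ω | Y 0 ω = i} = 1 := by
  simpa using h.measure_path hQ hneg 0 fun _ => i

theorem ae_chain_zero (h : IsJumpHolding Q i μ Y S) (hQ : IsRateMatrix Q)
    (hneg : ∀ i, Q i i < 0) : ∀ᵐ ω ∂μ, Y 0 ω = i :=
  (prob_compl_eq_zero_iff (h.measurableSet_chain 0 i)).2 (h.measure_chain_zero hQ hneg)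

/-- The first jump leaves the initial state, so that a return time to that state has a genuine
departure. -/
theorem ae_chain_one_ne (h : IsJumpHolding Q i μ Y S) (hQ : IsRateMatrix Q)
    (hneg : ∀ i, Q i i < 0) : ∀ᵐ ω ∂μ, Y 1 ω ≠ i := by
  have h1 := h.measure_inter_succ hQ hneg (m := 0) (C := {ω | Y 0 ω = i}) (a := i) i
    (fun ω ω' hωω' hω => (hωω' 0 le_rfl).symm.trans hω) fun ω hω => hω
  rw [jumpMatrix_self (hneg i), ENNReal.ofReal_zero, mul_zero, zero_add] at h1
  filter_upwards [h.ae_chain_zero hQ hneg, compl_mem_ae_iff.2 h1] with ω h2 h3 h4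
  exact h3 ⟨h2, h4⟩

theorem measure_avoids_inter (h : IsJumpHolding Q i μ Y S) (hQ : IsRateMatrix Q)
    (hneg : ∀ i, Q i i < 0) (e f : V) (l : ℕ) (k : V) :
    μ (avoids Y e f 0 l ∩ {ω | Y l ω = k}) = ENNReal.ofReal ((tabooMatrix Q e f ^ l) i k) := by
  have h1 := h.measure_inter_avoids hQ hneg (e := e) (f := f) (n := 0) (C := {ω | Y 0 ω = i})
    (j := i) (fun ω ω' hωω' hω => (hωω' 0 le_rfl).symm.trans hω) (fun ω hω => hω) l k
  rw [h.measure_chain_zero hQ hneg, one_mul] at h1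
  rw [← h1, zero_add]
  refine measure_congr ?_
  filter_upwards [h.ae_chain_zero hQ hneg] with ω hω
  exact propext ⟨fun h' => ⟨⟨hω, h'.1⟩, h'.2⟩, fun h' => ⟨h'.1.2, h'.2⟩⟩

theorem measure_firstVisit (h : IsJumpHolding Q i μ Y S) (hQ : IsRateMatrix Q)
    (hneg : ∀ i, Q i i < 0) (e f : V) (m : ℕ) :
    μ (firstVisit Y e f m) =
      ENNReal.ofReal ((tabooMatrix Q e f ^ m * jumpMatrix Q) i e) := by
  have h1 := h.measure_inter_avoids_inter_succ hQ hneg (e := e) (f := f) (n := 0)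
    (C := {ω | Y 0 ω = i}) (j := i) (fun ω ω' hωω' hω => (hωω' 0 le_rfl).symm.trans hω)
    (fun ω hω => hω) m e
  rw [h.measure_chain_zero hQ hneg, one_mul] at h1
  rw [← h1, zero_add]
  refine measure_congr ?_
  filter_upwards [h.ae_chain_zero hQ hneg] with ω hω
  exact propext ⟨fun h' => ⟨⟨hω, h'.1⟩, h'.2⟩, fun h' => ⟨h'.1.2, h'.2⟩⟩

/-- The event splits at step n into a past, avoiding {e, f} and ending in j, and a future started
from j. -/
theorem measure_firstVisit_inter (h : IsJumpHolding Q i μ Y S) (hQ : IsRateMatrix Q)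
    (hneg : ∀ i, Q i i < 0) (e f j : V) {m n : ℕ} (hnm : n ≤ m) :
    μ (firstVisit Y e f m ∩ {ω | Y n ω = j}) =
      ENNReal.ofReal ((tabooMatrix Q e f ^ n) i j) *
        ENNReal.ofReal ((tabooMatrix Q e f ^ (m - n) * jumpMatrix Q) j e) := by
  rw [← h.measure_avoids_inter hQ hneg e f n j, ← h.measure_inter_avoids_inter_succ hQ hneg
    (e := e) (f := f) (n := n) _ fun ω hω => hω.2]
  · rw [Nat.add_sub_cancel' hnm]
    congr 1
    ext ω
    simp only [firstVisit, avoids, Set.mem_inter_iff, Set.mem_ofPred_eq]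
    constructor
    · rintro ⟨⟨h1, h2⟩, h3⟩
      exact ⟨⟨⟨fun k hk hkn => h1 k hk (by omega), h3⟩,
        fun k hk hkn => h1 k (by omega) (by omega)⟩, h2⟩
    · rintro ⟨⟨⟨h1, h3⟩, h4⟩, h2⟩
      refine ⟨⟨fun k hk hkn => ?_, h2⟩, h3⟩
      by_cases hkn : k ≤ n
      · exact h1 k hk (by omega)
      · exact h4 k (by omega) (by omega)
  · rintro ω ω' hωω' ⟨h2, h3⟩
    refine ⟨fun m hm hml => ?_, (hωω' _ le_rfl).symm.trans h3⟩
    rw [← hωω' m (by omega)]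
    exact h2 m hm hml

/-- The jump chain almost surely visits `{e, f}` after step zero. -/
theorem ae_exists_visit (h : IsJumpHolding Q i μ Y S) (hQ : IsRateMatrix Q)
    (hirr : IsIrreducibleRate Q) (hneg : ∀ i, Q i i < 0) (e f : V) :
    ∀ᵐ ω ∂μ, ∃ n, 0 < n ∧ (Y n ω = e ∨ Y n ω = f) := by
  have hmeas : ∀ n, μ (avoids Y e f 0 n) =
      ENNReal.ofReal (∑ k, (tabooMatrix Q e f ^ n) i k) := fun n => by
    rw [measure_eq_sum_inter_preimage μ (h.measurable_chain n),
      ENNReal.ofReal_sum_of_nonneg fun k _ => hQ.tabooMatrix_pow_nonneg hneg n i k]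
    exact Finset.sum_congr rfl fun k _ => h.measure_avoids_inter hQ hneg e f n k
  have hlim : Filter.Tendsto (fun n => ENNReal.ofReal (∑ k, (tabooMatrix Q e f ^ n) i k))
      Filter.atTop (nhds 0) := by
    rw [← ENNReal.ofReal_zero]
    refine (ENNReal.continuous_ofReal.tendsto 0).comp ?_
    rw [← Finset.sum_const_zero (s := (Finset.univ : Finset V))]
    exact tendsto_finsetSum _ fun k _ =>
      (hQ.summable_tabooMatrix_pow hirr hneg i k).tendsto_atTop_zero
  -- Never visiting {e, f} implies avoiding it for n steps, and that probability is a finite sum of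
  -- general terms of convergent series.
  refine le_antisymm (ge_of_tendsto' hlim fun n => ?_) zero_le
  rw [← hmeas]
  refine measure_mono fun ω hω k hk _ => ?_
  have hω' : ¬∃ n, 0 < n ∧ (Y n ω = e ∨ Y n ω = f) := hω
  exact not_or.1 fun h' => hω' ⟨k, hk, h'⟩

end IsJumpHolding

end HittingEvents

end JumpProcess

namespace JumpProcess

/-! ### Hitting and occupation times along a single path -/

section Paths

variable {V Ω : Type*} [DecidableEq V] {Y : ℕ → Ω → V} {S : ℕ → Ω → ℝ≥0∞} {X : ℝ≥0 → Ω → V}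
  {ω : Ω}

omit [DecidableEq V] in
theorem jumpTime_succ (S : ℕ → Ω → ℝ≥0∞) (n : ℕ) (ω : Ω) :
    jumpTime S (n + 1) ω = jumpTime S n ω + S n ω :=
  Finset.sum_range_succ _ _

omit [DecidableEq V] in
theorem jumpTime_mono (S : ℕ → Ω → ℝ≥0∞) (ω : Ω) : Monotone fun n => jumpTime S n ω :=
  monotone_nat_of_le_succ fun n => by
    rw [jumpTime_succ]
    exact le_self_add

omit [DecidableEq V] in
theorem jumpTime_ne_top (hfin : ∀ n, S n ω < ∞) (n : ℕ) : jumpTime S n ω ≠ ∞ :=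
  (ENNReal.sum_lt_top.2 fun k _ => hfin k).ne

omit [DecidableEq V] in
theorem jumpTime_lt_succ (hpos : ∀ n, 0 < S n ω) (hfin : ∀ n, S n ω < ∞) (n : ℕ) :
    jumpTime S n ω < jumpTime S (n + 1) ω := by
  rw [jumpTime_succ]
  exact ENNReal.lt_add_right (jumpTime_ne_top hfin n) (hpos n).ne'

omit [DecidableEq V] in
theorem exists_jumpTime_le_lt {n : ℕ} {t : ℝ≥0∞} (ht : t < jumpTime S n ω) :
    ∃ k < n, jumpTime S k ω ≤ t ∧ t < jumpTime S (k + 1) ω := by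
  induction n with
  | zero => simp [jumpTime] at ht
  | succ n ih =>
    by_cases h : t < jumpTime S n ω
    · obtain ⟨k, hk, hk'⟩ := ih h
      exact ⟨k, by omega, hk'⟩
    · exact ⟨n, by omega, not_lt.1 h, ht⟩

omit [DecidableEq V] in
theorem apply_zero_of_path (hpos : ∀ n, 0 < S n ω)
    (hX : ∀ (n : ℕ) (t : ℝ≥0), jumpTime S n ω ≤ t → (t : ℝ≥0∞) < jumpTime S (n + 1) ω →
      X t ω = Y n ω) : X 0 ω = Y 0 ω :=
  hX 0 0 (by simp [jumpTime]) (by simpa [jumpTime] using hpos 0)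

theorem le_hitTime (hpos : ∀ n, 0 < S n ω)
    (hX : ∀ (n : ℕ) (t : ℝ≥0), jumpTime S n ω ≤ t → (t : ℝ≥0∞) < jumpTime S (n + 1) ω →
      X t ω = Y n ω) {e : V} {n : ℕ} (hne : ∀ k, 0 < k → k < n → Y k ω ≠ e) :
    jumpTime S n ω ≤ hitTime (fun t => X t ω) e := by
  have h0 := apply_zero_of_path hpos hX
  rw [hitTime]
  split_ifs with h
  · refine le_iInf₂ fun t ht => not_lt.1 fun hlt => ?_
    obtain ⟨-, ⟨u, -, hut, hu⟩, hte⟩ := ht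
    obtain ⟨k, hk, h1, h2⟩ := exists_jumpTime_le_lt hlt
    -- Only the initial holding interval escapes `hne`; during it the path has not yet left e, so no
    -- return can have occurred.
    have hk0 : k = 0 := by
      by_contra hk0
      exact hne k (Nat.pos_of_ne_zero hk0) hk ((hX k t h1 h2).symm.trans hte)
    subst hk0
    refine hu ?_
    rw [hX 0 u (by simp [jumpTime]) (lt_trans (by exact_mod_cast hut) h2), ← h0]
    exact h
  · refine le_iInf₂ fun t ht => not_lt.1 fun hlt => ?_
    obtain ⟨-, hte⟩ := ht
    obtain ⟨k, hk, h1, h2⟩ := exists_jumpTime_le_lt hlt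
    have hYk := (hX k t h1 h2).symm.trans hte
    rcases Nat.eq_zero_or_pos k with rfl | hk0
    · exact h (h0.trans hYk)
    · exact hne k hk0 hk hYk

theorem hitTime_le (hpos : ∀ n, 0 < S n ω) (hfin : ∀ n, S n ω < ∞)
    (hX : ∀ (n : ℕ) (t : ℝ≥0), jumpTime S n ω ≤ t → (t : ℝ≥0∞) < jumpTime S (n + 1) ω →
      X t ω = Y n ω) (h01 : Y 1 ω ≠ Y 0 ω) {e : V} {n : ℕ} (hn : 0 < n) (he : Y n ω = e) :
    hitTime (fun t => X t ω) e ≤ jumpTime S n ω := by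
  have h0 := apply_zero_of_path hpos hX
  have hcoe : ∀ m, ((jumpTime S m ω).toNNReal : ℝ≥0∞) = jumpTime S m ω := fun m =>
    ENNReal.coe_toNNReal (jumpTime_ne_top hfin m)
  have hmono : StrictMono fun m => jumpTime S m ω :=
    strictMono_nat_of_lt_succ (jumpTime_lt_succ hpos hfin)
  have hXm : ∀ m, X (jumpTime S m ω).toNNReal ω = Y m ω := fun m =>
    hX m _ (hcoe m).ge ((hcoe m).trans_lt (jumpTime_lt_succ hpos hfin m))
  have hlt : ∀ {k m : ℕ}, k < m → (jumpTime S k ω).toNNReal < (jumpTime S m ω).toNNReal := by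
    intro k m hkm
    rw [← ENNReal.coe_lt_coe, hcoe, hcoe]
    exact hmono hkm
  have hzero : (jumpTime S 0 ω).toNNReal = 0 := by simp [jumpTime]
  have hpos' : ∀ m, 0 < m → 0 < (jumpTime S m ω).toNNReal := fun m hm => hzero ▸ hlt hm
  rw [hitTime]
  split_ifs with h
  -- Started in e, the path has left it at the first jump time, which precedes the n-th one since `Y
  -- n` is back in e.
  · have h1e : Y 1 ω ≠ e := fun h' => h01 (h'.trans (h.symm.trans h0))
    have hn1 : 1 < n := lt_of_le_of_ne hn fun h' => h1e (h' ▸ he)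
    exact (iInf₂_le _ ⟨hpos' n hn, ⟨_, hpos' 1 one_pos, hlt hn1, (hXm 1).trans_ne h1e⟩,
      (hXm n).trans he⟩).trans_eq (hcoe n)
  · exact (iInf₂_le _ ⟨hpos' n hn, (hXm n).trans he⟩).trans_eq (hcoe n)

/-- Before the n-th jump, time is partitioned into the first n holding intervals, on each of which
the path is constant. Explosion is irrelevant here: only finitely many jumps precede the hit. -/
theorem timeSpent_eq_sum (hfin : ∀ n, S n ω < ∞)
    (hX : ∀ (n : ℕ) (t : ℝ≥0), jumpTime S n ω ≤ t → (t : ℝ≥0∞) < jumpTime S (n + 1) ω →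
      X t ω = Y n ω) {e : V} (j : V) {n : ℕ}
    (hit : hitTime (fun t => X t ω) e = jumpTime S n ω) :
    timeSpent (fun t => X t ω) e j =
      ∑ k ∈ Finset.range n, {ω | Y k ω = j}.indicator (S k) ω := by
  rw [timeSpent, hit]
  have hset : ∀ k, Set.Ico (jumpTime S k ω).toReal (jumpTime S (k + 1) ω).toReal ⊆
      Set.Ici (0 : ℝ) := fun k t ht => ENNReal.toReal_nonneg.trans ht.1
  have hvol : ∀ k, volume (Set.Ico (jumpTime S k ω).toReal (jumpTime S (k + 1) ω).toReal) =
      S k ω := fun k => by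
    rw [Real.volume_Ico, jumpTime_succ, ENNReal.toReal_add (jumpTime_ne_top hfin k) (hfin k).ne,
      add_sub_cancel_left, ENNReal.ofReal_toReal (hfin k).ne]
  have hpt : ∀ t ∈ Set.Ici (0 : ℝ), Set.indicator
      {t : ℝ | ENNReal.ofReal t < jumpTime S n ω ∧ X t.toNNReal ω = j}
        (fun _ => (1 : ℝ≥0∞)) t = ∑ k ∈ Finset.range n,
      (Set.Ico (jumpTime S k ω).toReal (jumpTime S (k + 1) ω).toReal).indicator
        (fun _ => if Y k ω = j then (1 : ℝ≥0∞) else 0) t := fun t ht => by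
    have hmem : ∀ k, t ∈ Set.Ico (jumpTime S k ω).toReal (jumpTime S (k + 1) ω).toReal ↔
        jumpTime S k ω ≤ ENNReal.ofReal t ∧ ENNReal.ofReal t < jumpTime S (k + 1) ω := fun k => by
      rw [Set.mem_Ico, ENNReal.le_ofReal_iff_toReal_le (jumpTime_ne_top hfin k) ht,
        ENNReal.ofReal_lt_iff_lt_toReal ht (jumpTime_ne_top hfin (k + 1))]
    by_cases hlt : ENNReal.ofReal t < jumpTime S n ω
    · obtain ⟨k, hk, h1, h2⟩ := exists_jumpTime_le_lt hlt
      rw [Finset.sum_eq_single_of_mem k (Finset.mem_range.2 hk),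
        Set.indicator_of_mem ((hmem k).2 ⟨h1, h2⟩), ← hX k t.toNNReal h1 h2]
      · simp only [Set.indicator_apply, Set.mem_ofPred_eq, hlt, true_and]
      · intro m _ hmk
        refine Set.indicator_of_notMem (fun hm => ?_) _
        rw [hmem] at hm
        rcases lt_or_gt_of_ne hmk with h3 | h3
        · exact absurd (hm.2.trans_le ((jumpTime_mono S ω (by omega : m + 1 ≤ k)).trans h1))
            (lt_irrefl _)
        · exact absurd (h2.trans_le ((jumpTime_mono S ω (by omega : k + 1 ≤ m)).trans hm.1))
            (lt_irrefl _)
    · rw [Set.indicator_of_notMem fun h' => hlt h'.1]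
      refine (Finset.sum_eq_zero fun k hk => Set.indicator_of_notMem (fun hm => hlt ?_) _).symm
      exact ((hmem k).1 hm).2.trans_le
        (jumpTime_mono S ω (Nat.succ_le_of_lt (Finset.mem_range.1 hk)))
  rw [setLIntegral_congr_fun measurableSet_Ici hpt, lintegral_finsetSum _ fun k _ =>
    measurable_const.indicator measurableSet_Ico]
  refine Finset.sum_congr rfl fun k _ => ?_
  rw [lintegral_indicator measurableSet_Ico, setLIntegral_const,
    Measure.restrict_apply measurableSet_Ico, Set.inter_eq_left.2 (hset k), hvol]
  by_cases hk : Y k ω = j <;> simp [hk]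

end Paths

end JumpProcess

namespace JumpProcess

/-! ### Hitting probabilities and mean times as series -/

section Assembly

variable {V Ω : Type*} [DecidableEq V] {Y : ℕ → Ω → V} {S : ℕ → Ω → ℝ≥0∞} {X : ℝ≥0 → Ω → V}
  {e f : V} {ω : Ω}

omit [DecidableEq V] in
theorem firstVisit_unique {m n : ℕ} (hm : ω ∈ firstVisit Y e f m) (hn : ω ∈ firstVisit Y e f n) :
    m = n := by
  by_contra hne
  rcases lt_or_gt_of_ne hne with h | h
  · exact (hn.1 (m + 1) (by omega) (by omega)).1 hm.2
  · exact (hm.1 (n + 1) (by omega) (by omega)).1 hn.2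

/-- The path properties which hold almost surely. -/
structure IsRegularPath (Y : ℕ → Ω → V) (S : ℕ → Ω → ℝ≥0∞) (X : ℝ≥0 → Ω → V) (ω : Ω) : Prop where
  pos : ∀ n, 0 < S n ω
  lt_top : ∀ n, S n ω < ∞
  chain_ne : Y 1 ω ≠ Y 0 ω
  path : ∀ (n : ℕ) (t : ℝ≥0),
    jumpTime S n ω ≤ t → (t : ℝ≥0∞) < jumpTime S (n + 1) ω → X t ω = Y n ω

namespace IsRegularPath

theorem hitTime_eq (h : IsRegularPath Y S X ω) {m : ℕ} (hm : ω ∈ firstVisit Y e f m) :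
    hitTime (fun t => X t ω) e = jumpTime S (m + 1) ω :=
  le_antisymm (hitTime_le h.pos h.lt_top h.path h.chain_ne m.succ_pos hm.2)
    (le_hitTime h.pos h.path fun k hk hkm => (hm.1 k hk (by omega)).1)

theorem hitTime_lt (h : IsRegularPath Y S X ω) (hef : e ≠ f) {m : ℕ}
    (hm : ω ∈ firstVisit Y e f m) :
    hitTime (fun t => X t ω) e < hitTime (fun t => X t ω) f := by
  rw [h.hitTime_eq hm]
  -- At step m + 1 the chain is in e, not f, so f is hit no earlier than the jump of index m + 2.
  refine (jumpTime_lt_succ h.pos h.lt_top (m + 1)).trans_le (le_hitTime h.pos h.path ?_)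
  intro k hk hkm
  rcases Nat.lt_succ_iff_lt_or_eq.1 hkm with hlt | rfl
  · exact (hm.1 k hk (by omega)).2
  · exact hm.2.trans_ne hef

theorem mem_hitsBefore_iff (h : IsRegularPath Y S X ω) (hef : e ≠ f)
    (hvisit : ∃ n, 0 < n ∧ (Y n ω = e ∨ Y n ω = f)) :
    ω ∈ hitsBefore X e f ↔ ∃ m, ω ∈ firstVisit Y e f m := by
  classical
  refine ⟨fun hlt => ?_, fun ⟨m, hm⟩ => h.hitTime_lt hef hm⟩
  obtain ⟨hpos, hn⟩ := Nat.find_spec hvisit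
  have hmin : ∀ k, 0 < k → k < Nat.find hvisit → Y k ω ≠ e ∧ Y k ω ≠ f := fun k hk hlt =>
    not_or.1 fun h' => Nat.find_min hvisit hlt ⟨hk, h'⟩
  obtain ⟨m, hm⟩ : ∃ m, Nat.find hvisit = m + 1 := ⟨_, (Nat.succ_pred_eq_of_pos hpos).symm⟩
  rw [hm] at hn hmin
  rcases hn with hn | hn
  · exact ⟨m, fun k hk hkm => hmin k hk (by omega), hn⟩
  -- Had the first visit been in f, the same comparison with e and f exchanged would put f first.
  · have hm' : ω ∈ firstVisit Y f e m := ⟨fun k hk hkm => (hmin k hk (by omega)).symm, hn⟩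
    exact absurd (h.hitTime_lt hef.symm hm') (lt_asymm hlt)

theorem restrictedTime_eq (h : IsRegularPath Y S X ω) (hef : e ≠ f)
    (hvisit : ∃ n, 0 < n ∧ (Y n ω = e ∨ Y n ω = f)) (j : V) :
    restrictedTime X e f j ω = (∑' m, ∑ n ∈ Finset.range (m + 1),
      (firstVisit Y e f m ∩ {ω | Y n ω = j}).indicator (S n) ω).toReal := by
  simp only [restrictedTime]
  by_cases hω : ω ∈ hitsBefore X e f
  · obtain ⟨m, hm⟩ := (h.mem_hitsBefore_iff hef hvisit).1 hω
    rw [Set.indicator_of_mem hω, timeSpent_eq_sum h.lt_top h.path j (h.hitTime_eq hm),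
      tsum_eq_single m]
    · congr 1
      refine Finset.sum_congr rfl fun n _ => ?_
      rw [← Set.indicator_indicator, Set.indicator_of_mem hm]
    · exact fun m' hm' => Finset.sum_eq_zero fun n _ =>
        Set.indicator_of_notMem (fun h' => hm' (firstVisit_unique h'.1 hm)) _
  · rw [Set.indicator_of_notMem hω, eq_comm, ENNReal.toReal_eq_zero_iff]
    refine Or.inl (ENNReal.tsum_eq_zero.2 fun m => Finset.sum_eq_zero fun n _ =>
      Set.indicator_of_notMem (fun h' => hω ?_) _)
    exact (h.mem_hitsBefore_iff hef hvisit).2 ⟨m, h'.1⟩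

end IsRegularPath

variable [Fintype V] [MeasurableSpace V] [MeasurableSingletonClass V] [MeasurableSpace Ω]
  {Q : Matrix V V ℝ}

namespace IsJumpHolding

variable {i : V} {μ : Measure Ω} [IsProbabilityMeasure μ]

theorem ae_isRegularPath (h : IsJumpHolding Q i μ Y S) (hQ : IsRateMatrix Q)
    (hneg : ∀ i, Q i i < 0)
    (hX : ∀ᵐ ω ∂μ, ∀ (n : ℕ) (t : ℝ≥0),
      jumpTime S n ω ≤ t → (t : ℝ≥0∞) < jumpTime S (n + 1) ω → X t ω = Y n ω) :
    ∀ᵐ ω ∂μ, IsRegularPath Y S X ω := by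
  filter_upwards [h.ae_pos hQ hneg, h.ae_lt_top hQ hneg, h.ae_chain_zero hQ hneg,
    h.ae_chain_one_ne hQ hneg, hX] with ω h1 h2 h3 h4 h5
  exact ⟨h1, h2, h3 ▸ h4, h5⟩

theorem hitProb_eq_tsum (h : IsJumpHolding Q i μ Y S) (hQ : IsRateMatrix Q)
    (hirr : IsIrreducibleRate Q) (hneg : ∀ i, Q i i < 0) (hef : e ≠ f)
    (hX : ∀ᵐ ω ∂μ, ∀ (n : ℕ) (t : ℝ≥0),
      jumpTime S n ω ≤ t → (t : ℝ≥0∞) < jumpTime S (n + 1) ω → X t ω = Y n ω) :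
    hitProb μ X e f = ∑' m, (tabooMatrix Q e f ^ m * jumpMatrix Q) i e := by
  -- Almost sure equality with a disjoint union of measurable events replaces a direct proof that
  -- `hitsBefore` is measurable.
  have hae : hitsBefore X e f =ᵐ[μ] ⋃ m, firstVisit Y e f m := by
    filter_upwards [h.ae_isRegularPath hQ hneg hX, h.ae_exists_visit hQ hirr hneg e f]
      with ω h1 h2
    refine propext ((h1.mem_hitsBefore_iff hef h2).trans ?_)
    exact Set.mem_iUnion.symm
  rw [hitProb, measureReal_congr hae, measureReal_def, measure_iUnion _
    fun m => h.measurableSet_firstVisit e f m]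
  · simp_rw [h.measure_firstVisit hQ hneg]
    have hnn := hQ.tabooMatrix_pow_mul_jumpMatrix_nonneg hneg e f
    rw [← ENNReal.ofReal_tsum_of_nonneg (fun m => hnn m i e)
      (hQ.summable_tabooMatrix_pow_mul_jumpMatrix hirr hneg e f i e),
      ENNReal.toReal_ofReal (tsum_nonneg fun m => hnn m i e)]
  · exact fun m n hmn => Set.disjoint_left.2 fun ω hm hn => hmn (firstVisit_unique hm hn)

theorem lintegral_timeBeforeVisit (h : IsJumpHolding Q i μ Y S) (hQ : IsRateMatrix Q)
    (hirr : IsIrreducibleRate Q) (hneg : ∀ i, Q i i < 0) (e f j : V) :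
    ∫⁻ ω, ∑' m, ∑ n ∈ Finset.range (m + 1),
      (firstVisit Y e f m ∩ {ω | Y n ω = j}).indicator (S n) ω ∂μ =
    ENNReal.ofReal ((-Q j j)⁻¹ * (∑' m, (tabooMatrix Q e f ^ m * jumpMatrix Q) j e) *
      ∑' n, (tabooMatrix Q e f ^ n) i j) := by
  have hset : ∀ m n, MeasurableSet (firstVisit Y e f m ∩ {ω | Y n ω = j}) := fun m n =>
    (h.measurableSet_firstVisit e f m).inter (h.measurableSet_chain n j)
  have hmeas : ∀ m n, Measurable ((firstVisit Y e f m ∩ {ω | Y n ω = j}).indicator (S n)) :=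
    fun m n => (h.measurable_holding n).indicator (hset m n)
  have hM := fun n => hQ.tabooMatrix_pow_nonneg (e := e) (f := f) hneg n i j
  have hK := fun n => hQ.tabooMatrix_pow_mul_jumpMatrix_nonneg hneg e f n j e
  have hMs := (hQ.summable_tabooMatrix_pow (e := e) (f := f) hirr hneg i j).norm
  have hKs := (hQ.summable_tabooMatrix_pow_mul_jumpMatrix hirr hneg e f j e).norm
  have hq : 0 ≤ (-Q j j)⁻¹ := inv_nonneg.2 (by linarith [hneg j])
  have hnn : ∀ m, 0 ≤ ∑ n ∈ Finset.range (m + 1), (tabooMatrix Q e f ^ n) i j *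
      (tabooMatrix Q e f ^ (m - n) * jumpMatrix Q) j e := fun m =>
    Finset.sum_nonneg fun n _ => mul_nonneg (hM n) (hK (m - n))
  -- Sum and integral commute by nonnegativity; on the right, the product of the two series becomes
  -- a Cauchy product indexed by n ≤ m.
  rw [lintegral_tsum fun m =>
    (Finset.measurable_sum (Finset.range (m + 1)) fun n _ => hmeas m n).aemeasurable,
    mul_assoc, mul_comm (tsum _) (tsum _),
    tsum_mul_tsum_eq_tsum_sum_range_of_summable_norm hMs hKs, ← tsum_mul_left,
    ENNReal.ofReal_tsum_of_nonneg (fun m => mul_nonneg hq (hnn m))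
      ((summable_norm_sum_mul_range_of_summable_norm hMs hKs).of_norm.mul_left _)]
  refine tsum_congr fun m => ?_
  rw [lintegral_finsetSum _ fun n _ => hmeas m n, Finset.mul_sum,
    ENNReal.ofReal_sum_of_nonneg fun n _ => mul_nonneg hq (mul_nonneg (hM n) (hK (m - n)))]
  refine Finset.sum_congr rfl fun n hn => ?_
  have hnm : n ≤ m := Nat.lt_succ_iff.1 (Finset.mem_range.1 hn)
  -- The event is determined by the chain up to step m + 1, hence that cutoff.
  rw [lintegral_indicator (hset m n), h.setLIntegral_holding hQ hneg (m := m + 1) (by omega) _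
    fun ω hω => hω.2, h.measure_firstVisit_inter hQ hneg e f j hnm, mul_comm (-Q j j)⁻¹,
    ENNReal.ofReal_mul (mul_nonneg (hM n) (hK _)), ENNReal.ofReal_mul (hM n)]
  rintro ω ω' hωω' ⟨⟨h1, h2⟩, h3⟩
  refine ⟨⟨fun k hk hkm => ?_, (hωω' _ le_rfl).symm.trans h2⟩,
    (hωω' n (by omega)).symm.trans h3⟩
  rw [← hωω' k (by omega)]
  exact h1 k hk hkm

theorem integrable_restrictedTime_and_meanTime_eq (h : IsJumpHolding Q i μ Y S)
    (hQ : IsRateMatrix Q) (hirr : IsIrreducibleRate Q) (hneg : ∀ i, Q i i < 0) (hef : e ≠ f)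
    (hX : ∀ᵐ ω ∂μ, ∀ (n : ℕ) (t : ℝ≥0),
      jumpTime S n ω ≤ t → (t : ℝ≥0∞) < jumpTime S (n + 1) ω → X t ω = Y n ω) (j : V) :
    Integrable (restrictedTime X e f j) μ ∧
      meanTime μ X e f j =
        (-Q j j)⁻¹ * (∑' m, (tabooMatrix Q e f ^ m * jumpMatrix Q) j e) *
          ∑' n, (tabooMatrix Q e f ^ n) i j := by
  have hae : restrictedTime X e f j =ᵐ[μ] fun ω => (∑' m, ∑ n ∈ Finset.range (m + 1),
      (firstVisit Y e f m ∩ {ω | Y n ω = j}).indicator (S n) ω).toReal := by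
    filter_upwards [h.ae_isRegularPath hQ hneg hX, h.ae_exists_visit hQ hirr hneg e f]
      with ω h1 h2
    exact h1.restrictedTime_eq hef h2 j
  have hmeas : Measurable fun ω => ∑' m, ∑ n ∈ Finset.range (m + 1),
      (firstVisit Y e f m ∩ {ω | Y n ω = j}).indicator (S n) ω :=
    Measurable.tsum fun m => Finset.measurable_sum _ fun n _ =>
      (h.measurable_holding n).indicator
        ((h.measurableSet_firstVisit e f m).inter (h.measurableSet_chain n j))
  have hint := h.lintegral_timeBeforeVisit hQ hirr hneg e f j
  have hne := hint.trans_ne ENNReal.ofReal_ne_top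
  refine ⟨(integrable_congr hae).2 (integrable_toReal_of_lintegral_ne_top hmeas.aemeasurable hne),
    ?_⟩
  rw [meanTime, integral_congr_ae hae, integral_toReal hmeas.aemeasurable
    (ae_lt_top' hmeas.aemeasurable hne), hint, ENNReal.toReal_ofReal]
  exact mul_nonneg (mul_nonneg (inv_nonneg.2 (by linarith [hneg j]))
    (tsum_nonneg fun m => hQ.tabooMatrix_pow_mul_jumpMatrix_nonneg hneg e f m j e))
    (tsum_nonneg fun n => hQ.tabooMatrix_pow_nonneg hneg n i j)

end IsJumpHolding

omit [Fintype V] [MeasurableSpace V] [MeasurableSingletonClass V] in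
theorem meanTime_eq_zero_of_hitProb_eq_zero {μ : Measure Ω} [IsFiniteMeasure μ] {j : V}
    (h : hitProb μ X e f = 0) : meanTime μ X e f j = 0 := by
  have h0 : μ (hitsBefore X e f) = 0 := (measureReal_eq_zero_iff).1 h
  refine integral_eq_zero_of_ae ?_
  filter_upwards [compl_mem_ae_iff.2 h0] with ω hω
  exact Set.indicator_of_notMem hω _

end Assembly

end JumpProcess

theorem proposition4 {V Ω : Type*} [Fintype V] [DecidableEq V]
    [MeasurableSpace V] [MeasurableSingletonClass V] [MeasurableSpace Ω]
    (Q : Matrix V V ℝ) (hQ : JumpProcess.IsRateMatrix Q) (hirr : JumpProcess.IsIrreducibleRate Q)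
    (v₁ v₂ : V) (hv : v₁ ≠ v₂)
    (P : V → Measure Ω) [∀ i, IsProbabilityMeasure (P i)] (X : ℝ≥0 → Ω → V)
    (hX : ∀ i, JumpProcess.IsMarkovJumpProcess Q i (P i) X)
    (j : V) (hj₁ : j ≠ v₁) (hj₂ : j ≠ v₂)
    (e f : V) (hef : (e = v₁ ∧ f = v₂) ∨ (e = v₂ ∧ f = v₁)) :
    (∀ i, Integrable (JumpProcess.restrictedTime X e f j) (P i)) ∧
    (∀ i, 0 ≤ JumpProcess.meanTime (P i) X e f j) ∧
    (∀ u : V → ℝ,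
      (JumpProcess.reducedMatrix Q v₁ v₂).mulVec u =
          -(JumpProcess.hitProb (P j) X e f) • Pi.single j (1 : ℝ) ↔
        u = fun i => JumpProcess.meanTime (P i) X e f j) ∧
    (∀ i, JumpProcess.meanTime (P i) X e f j = 0 →
      JumpProcess.condMeanTime (P i) X e f j = 0) ∧
    (∀ i, 0 < JumpProcess.meanTime (P i) X e f j →
      0 < JumpProcess.hitProb (P i) X e f ∧
      JumpProcess.condMeanTime (P i) X e f j =
        JumpProcess.meanTime (P i) X e f j / JumpProcess.hitProb (P i) X e f) := by
  have hneg : ∀ i, Q i i < 0 := fun i => by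
    by_cases h : i = v₁
    · exact hQ.diag_neg hirr (h.trans_ne hv)
    · exact hQ.diag_neg hirr h
  have hne : e ≠ f := by
    rcases hef with ⟨rfl, rfl⟩ | ⟨rfl, rfl⟩
    · exact hv
    · exact hv.symm
  have hred : JumpProcess.reducedMatrix Q v₁ v₂ = JumpProcess.reducedMatrix Q e f := by
    rcases hef with ⟨rfl, rfl⟩ | ⟨rfl, rfl⟩
    · rfl
    · exact JumpProcess.reducedMatrix_comm Q _ _
  have hchain : ∀ i, ∃ (Y : ℕ → Ω → V) (S : ℕ → Ω → ℝ≥0∞),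
      JumpProcess.IsJumpHolding Q i (P i) Y S ∧ ∀ᵐ ω ∂P i, ∀ (n : ℕ) (t : ℝ≥0),
        JumpProcess.jumpTime S n ω ≤ t → (t : ℝ≥0∞) < JumpProcess.jumpTime S (n + 1) ω →
          X t ω = Y n ω := fun i => by
    obtain ⟨Y, S, hY, hS, hlaw, hpath⟩ := hX i
    exact ⟨Y, S, ⟨hY, hS, hlaw⟩, hpath⟩
  have hmain : ∀ i, Integrable (JumpProcess.restrictedTime X e f j) (P i) ∧
      JumpProcess.meanTime (P i) X e f j = (-Q j j)⁻¹ * JumpProcess.hitProb (P j) X e f *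
        ∑' n, (JumpProcess.tabooMatrix Q e f ^ n) i j := fun i => by
    -- The realisations from i and from j may be unrelated; they are linked only through series
    -- depending on `Q` alone.
    obtain ⟨Y, S, h, hpath⟩ := hchain i
    obtain ⟨Y', S', h', hpath'⟩ := hchain j
    rw [h'.hitProb_eq_tsum hQ hirr hneg hne hpath']
    exact h.integrable_restrictedTime_and_meanTime_eq hQ hirr hneg hne hpath j
  refine ⟨fun i => (hmain i).1, fun i => ?_, fun u => ?_, fun i hi => ?_, fun i hi => ?_⟩
  · exact integral_nonneg fun ω => Set.indicator_nonneg (fun _ _ => ENNReal.toReal_nonneg) ω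
  · rw [hred, hQ.reducedMatrix_mulVec_eq_iff hirr hneg, funext fun i => (hmain i).2]
  · simp [JumpProcess.condMeanTime, hi]
  · have hp : JumpProcess.hitProb (P i) X e f ≠ 0 := fun h0 =>
      hi.ne' (JumpProcess.meanTime_eq_zero_of_hitProb_eq_zero h0)
    exact ⟨lt_of_le_of_ne measureReal_nonneg hp.symm, if_pos hp⟩
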